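/- Let $p$ be a prime. For $n\ge 0$ let $R_n$ be the space of complex class functions on $GL_n(\mathbb{F}_p)$ that vanish outside the $p$-regular elements (those of order prime to $p$, equivalently the semisimple ones), and give $\bigoplus_{n\ge 0}R_n$ the induction product: for $\rho\in R_n$, $\sigma\in R_m$ and $g\in GL_{n+m}(\mathbb{F}_p)$, $$(\rho\cdot\sigma)(g)=\frac{1}{|GL_n(\mathbb{F}_p)|\,|GL_m(\mathbb{F}_p)|}\sum_{h}\rho(a)\sigma(b),$$ where the sum is over the $h\in GL_{n+m}(\mathbb{F}_p)$ such that $hgh^{-1}=\begin{pmatrix}a&0\\0&b\end{pmatrix}$ for some $a\in GL_n(\mathbb{F}_p)$, $b\in GL_m(\mathbb{F}_p)$. For a monic polynomial $f\in\mathbb{F}_p[x]$ of degree $n$ with $f(0)\neq 0$, let $\pi_f\in R_n$ be the function that takes the value $1$ at the $p$-regular elements with characteristic polynomial $f$, and $0$ at all other elements. For $k\ge 0$ put $\psi_k(q)=\prod_{i=1}^{k}(q^i-1)$. Proposition. Let $f$ and $g$ be monic polynomials in $\mathbb{F}_p[x]$ with non-zero constant terms. 1. If $f$ and $g$ are coprime,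 then $\pi_f\cdot\pi_g=\pi_{fg}$. 2. If $f$ is irreducible of degree $d$, then for all integers $n,m\ge 0$, $$\pi_{f^n}\cdot\pi_{f^m}=p^{dmn}\,\frac{\psi_{n+m}(p^d)}{\psi_n(p^d)\,\psi_m(p^d)}\,\pi_{f^{n+m}}.$$ -/

import Mathlib

open scoped DirectSum

noncomputable section

namespace RegClass

/-- The general linear group `GL_n(𝔽_p)`. -/
abbrev GLp (p n : ℕ) : Type := Matrix.GeneralLinearGroup (Fin n) (ZMod p)

/-- The multiplicative map `(A, B) ↦ diag(A, B)` from pairs of matrices to matrices of size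
`n + m`. -/
def blockDiagMatrix (p n m : ℕ) :
    Matrix (Fin n) (Fin n) (ZMod p) × Matrix (Fin m) (Fin m) (ZMod p) →*
      Matrix (Fin (n + m)) (Fin (n + m)) (ZMod p) where
  toFun x := Matrix.reindex finSumFinEquiv finSumFinEquiv (Matrix.fromBlocks x.1 0 0 x.2)
  map_one' := by simp [Matrix.fromBlocks_one]
  map_mul' x y := by
    simp [Matrix.submatrix_mul_equiv, Matrix.fromBlocks_multiply]

/-- The block diagonal embedding `GL_n(𝔽_p) × GL_m(𝔽_p) → GL_{n+m}(𝔽_p)`,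
`(a, b) ↦ diag(a, b)`. -/
def blockDiag (p n m : ℕ) : GLp p n × GLp p m →* GLp p (n + m) :=
  (Units.map (blockDiagMatrix p n m)).comp MulEquiv.prodUnits.symm.toMonoidHom

/-- An element of `GL_n(𝔽_p)` is `p`-regular if its order is prime to `p`; for `p` prime this
means that it is semisimple. -/
def IsPRegular {p n : ℕ} (g : GLp p n) : Prop := (orderOf g).Coprime p

/-- The complex class functions on `GL_n(𝔽_p)` that vanish outside the `p`-regular elements. -/
def RegClassFun (p n : ℕ) : Submodule ℂ (GLp p n → ℂ) where
  carrier := {ρ | (∀ h g, ρ (h * g * h⁻¹) = ρ g) ∧ ∀ g, ¬ IsPRegular g → ρ g = 0}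
  add_mem' := by
    rintro ρ σ ⟨h1, h2⟩ ⟨h3, h4⟩
    refine ⟨fun h g => ?_, fun g hg => ?_⟩
    · simp only [Pi.add_apply, h1, h3]
    · simp only [Pi.add_apply, h2 g hg, h4 g hg, add_zero]
  zero_mem' := ⟨fun _ _ => rfl, fun _ _ => rfl⟩
  smul_mem' := by
    rintro c ρ ⟨h1, h2⟩
    refine ⟨fun h g => ?_, fun g hg => ?_⟩
    · simp only [Pi.smul_apply, h1]
    · simp only [Pi.smul_apply, h2 g hg, smul_zero]

open Classical in
/-- The induction product of two functions: the value at `g` is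
`1 / (|GL_n| |GL_m|) * ∑ ρ(a) σ(b)`, the sum being over the `h` in `GL_{n+m}(𝔽_p)` for which
`h g h⁻¹` is a block diagonal matrix `diag(a, b)`. The blocks `a` and `b` are determined by `h`,
so this is a sum over the triples `(h, a, b)` with `h g h⁻¹ = diag(a, b)`. -/
def indFun {p : ℕ} [Fact p.Prime] {n m : ℕ} (ρ : GLp p n → ℂ) (σ : GLp p m → ℂ) :
    GLp p (n + m) → ℂ := fun g =>
  1 / ((Fintype.card (GLp p n) : ℂ) * (Fintype.card (GLp p m) : ℂ)) *
    ∑ h : GLp p (n + m), ∑ a : GLp p n, ∑ b : GLp p m,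
      if h * g * h⁻¹ = blockDiag p n m (a, b) then ρ a * σ b else 0

theorem isPRegular_conj {p n : ℕ} (h g : GLp p n) : IsPRegular (h * g * h⁻¹) ↔ IsPRegular g := by
  unfold IsPRegular
  rw [← MulAut.conj_apply, MulEquiv.orderOf_eq]

theorem isPRegular_blockDiag {p n m : ℕ} {a : GLp p n} {b : GLp p m}
    (ha : IsPRegular a) (hb : IsPRegular b) : IsPRegular (blockDiag p n m (a, b)) := by
  unfold IsPRegular at *
  refine Nat.Coprime.coprime_dvd_left (orderOf_map_dvd _ _) ?_
  rw [Prod.orderOf]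
  exact Nat.Coprime.coprime_dvd_left (Nat.lcm_dvd_mul _ _) (Nat.Coprime.mul_left ha hb)

theorem indFun_mem {p : ℕ} [Fact p.Prime] {n m : ℕ} {ρ : GLp p n → ℂ} {σ : GLp p m → ℂ}
    (hρ : ρ ∈ RegClassFun p n) (hσ : σ ∈ RegClassFun p m) :
    indFun ρ σ ∈ RegClassFun p (n + m) := by
  refine ⟨fun k g => ?_, fun g hg => ?_⟩
  · unfold indFun
    rw [← Equiv.sum_comp (Equiv.mulRight k⁻¹)]
    simp only [Equiv.coe_mulRight, mul_inv_rev, inv_inv, mul_assoc, inv_mul_cancel_left]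
  · unfold indFun
    rw [Finset.sum_eq_zero, mul_zero]
    intro h _
    refine Finset.sum_eq_zero fun a _ => Finset.sum_eq_zero fun b _ => ?_
    split_ifs with e
    · by_cases ha : IsPRegular a
      · by_cases hb : IsPRegular b
        · refine absurd ?_ hg
          rw [← isPRegular_conj h g, e]
          exact isPRegular_blockDiag ha hb
        · rw [hσ.2 b hb, mul_zero]
      · rw [hρ.2 a ha, zero_mul]
    · rfl

/-- The induction product, in each bidegree, and its biadditivity; they make the graded space
`⨁ n, RegClassFun p n` an algebra with multiplication `*`. -/
instance instGradedMul (p : ℕ) [Fact p.Prime] :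
    DirectSum.GNonUnitalNonAssocSemiring (fun n : ℕ => RegClassFun p n) where
  mul {_ _} ρ σ := ⟨indFun ρ.1 σ.1, indFun_mem ρ.2 σ.2⟩
  mul_zero {_ _} ρ := by
    ext g
    simp [indFun]
  zero_mul {_ _} σ := by
    ext g
    simp [indFun]
  mul_add {_ _} ρ σ τ := by
    ext g
    simp only [indFun, Submodule.coe_add, Pi.add_apply, ← mul_add, ← Finset.sum_add_distrib]
    refine congrArg _ (Finset.sum_congr rfl fun h _ => Finset.sum_congr rfl fun a _ =>
      Finset.sum_congr rfl fun b _ => ?_)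
    split_ifs
    · ring
    · simp
  add_mul {_ _} ρ σ τ := by
    ext g
    simp only [indFun, Submodule.coe_add, Pi.add_apply, ← mul_add, ← Finset.sum_add_distrib]
    refine congrArg _ (Finset.sum_congr rfl fun h _ => Finset.sum_congr rfl fun a _ =>
      Finset.sum_congr rfl fun b _ => ?_)
    split_ifs
    · ring
    · simp

/-- The graded algebra of `p`-regular class functions on the groups `GL_n(𝔽_p)`, `n ≥ 0`. -/
abbrev RegClassAlg (p : ℕ) : Type := ⨁ n : ℕ, RegClassFun p n

open Classical in
/-- The function on `GL_n(𝔽_p)` with value `1` at the `p`-regular elements whose characteristic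
polynomial is `f`, and `0` elsewhere. -/
def piFun (p n : ℕ) (f : Polynomial (ZMod p)) : RegClassFun p n :=
  ⟨fun g => if IsPRegular g ∧ (g : Matrix (Fin n) (Fin n) (ZMod p)).charpoly = f then 1 else 0, by
    refine ⟨fun h g => ?_, fun g hg => if_neg fun H => hg H.1⟩
    have e : ((h * g * h⁻¹ : GLp p n) : Matrix (Fin n) (Fin n) (ZMod p)).charpoly =
        (g : Matrix (Fin n) (Fin n) (ZMod p)).charpoly := by
      simp
    simp only [isPRegular_conj, e]⟩

/-- The element `π_f`, homogeneous of degree `deg f`. -/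
def piElt {p : ℕ} (f : Polynomial (ZMod p)) : RegClassAlg p :=
  DirectSum.of (fun n : ℕ => RegClassFun p n) f.natDegree (piFun p f.natDegree f)

/-- `ψ_k(q) = (q - 1)(q² - 1)⋯(q^k - 1)`. -/
def psi (k : ℕ) (q : ℂ) : ℂ := ∏ i ∈ Finset.Icc 1 k, (q ^ i - 1)

end RegClass

end

/-!
Let `f` and `g` be coprime, and let `x` be a `p`-regular matrix with characteristic polynomial
`f * g`. The space is the direct sum of the kernels of `f(x)` and `g(x)`, so `x` is conjugate to some
`diag(a, b)` with `a`, `b` of characteristic polynomials `f`, `g` (`exists_conj_fromBlocks`). A matrix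
conjugating `diag(a, b)` to another such `diag(a', b')` is block diagonal, because there are no
nonzero intertwiners between the blocks of coprime characteristic polynomials
(`mem_range_blockDiag_of_conj`). Hence exactly `|GL_n| |GL_m|` conjugators contribute to the induction
product, each with value `1`, and the product has value `1` at `x`.

Let `f` be irreducible of degree `d` and `K = 𝔽_p[X]/(f)`, a field with `q = p ^ d` elements. A matrix
of size `d * N` is `p`-regular with characteristic polynomial `f ^ N` if and only if it is annihilated
by `f` (`isPRegular_and_charpoly_eq_pow_iff`), that is, if and only if it makes the space of column
vectors a `K`-vector space of dimension `N` on which it acts as the class of `X`. These matrices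
therefore form one conjugacy class (`isConj_of_aeval_eq_zero`) with centralizer `GL_N(K)`
(`card_centralizer_of_aeval_eq_zero`). So `π_{f^n} · π_{f^m}` is a multiple of `π_{f^{n+m}}`, and the
factor is found by summing over the whole group: the sum of an induction product is the product of
the sums times `|GL_{k+l}| / (|GL_k| |GL_l|)` (`sum_indFun`), and the sum of `π_{f^N}` is
`|GL_{dN}(𝔽_p)| / |GL_N(K)|` (`sum_piFun_mul_card`). The factor is
`|GL_{n+m}(K)| / (|GL_n(K)| |GL_m(K)|)`, and `|GL_N(K)| = q ^ (N.choose 2) * ψ_N(q)` gives its value.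
-/

namespace RegClass

open Polynomial

/-! ### Characteristic polynomials -/

/-- The matrix form of the remainder theorem: `X - A` divides `f(X) - f(A)`. -/
theorem exists_charmatrix_mul_eq {R ι : Type*} [CommRing R] [Fintype ι] [DecidableEq ι]
    (A : Matrix ι ι R) (f : R[X]) :
    ∃ Q : Matrix ι ι R[X],
      Matrix.scalar ι f - C.mapMatrix (aeval A f) = A.charmatrix * Q := by
  induction f using Polynomial.induction_on with
  | C a =>
    refine ⟨0, ?_⟩
    ext i j
    by_cases h : i = j <;> simp [Matrix.algebraMap_matrix_apply, h]
  | add f g hf hg =>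
    obtain ⟨Q, hQ⟩ := hf
    obtain ⟨S, hS⟩ := hg
    refine ⟨Q + S, ?_⟩
    rw [mul_add, ← hQ, ← hS, map_add, map_add, map_add]
    abel
  | monomial n a h =>
    obtain ⟨Q, hQ⟩ := h
    refine ⟨Matrix.scalar ι (C a * X ^ n) + Q * C.mapMatrix A, ?_⟩
    rw [mul_add, ← mul_assoc A.charmatrix, ← hQ, pow_succ, ← mul_assoc (C a), map_mul (aeval A),
      aeval_X, Matrix.charmatrix]
    rw [sub_mul, map_mul (RingHom.mapMatrix C), map_mul (Matrix.scalar ι), sub_mul,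
      ((Matrix.scalar_commute X (fun r => Commute.all _ r) _).eq :
        Matrix.scalar ι X * Matrix.scalar ι (C a * X ^ n) = _),
      ← (Matrix.scalar_commute (C a * X ^ n) (fun r => Commute.all _ r) (C.mapMatrix A)).eq]
    abel

/-- Taking determinants in the divisibility of `f(X) - f(A) = f(X)` by `X - A`. -/
theorem charpoly_dvd_pow_card {R ι : Type*} [CommRing R] [Fintype ι] [DecidableEq ι]
    {A : Matrix ι ι R} {f : R[X]} (h : aeval A f = 0) :
    A.charpoly ∣ f ^ Fintype.card ι := by
  obtain ⟨Q, hQ⟩ := exists_charmatrix_mul_eq A f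
  refine ⟨Q.det, ?_⟩
  rw [Matrix.charpoly, ← Matrix.det_mul, ← hQ, h, map_zero, sub_zero]
  simp

theorem linearMap_charpoly_dvd_pow {F V : Type*} [Field F] [AddCommGroup V] [Module F V]
    [FiniteDimensional F V] {L : Module.End F V} {f : F[X]} (h : aeval L f = 0) :
    L.charpoly ∣ f ^ Module.finrank F V := by
  classical
  let b := Module.finBasis F V
  have h2 : aeval (LinearMap.toMatrixAlgEquiv b L) f = 0 := by
    rw [aeval_algHom_apply, h, map_zero]
  have h3 := charpoly_dvd_pow_card h2
  rw [Fintype.card_fin] at h3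
  rwa [← LinearMap.charpoly_toMatrix L b]

theorem charpoly_eq_pow_of_aeval_eq_zero {F : Type*} [Field F] {k N : ℕ}
    {A : Matrix (Fin k) (Fin k) F} {f : F[X]} (hf : Irreducible f) (hm : f.Monic)
    (hk : k = N * f.natDegree) (h : aeval A f = 0) : A.charpoly = f ^ N := by
  obtain ⟨i, -, hi⟩ := (dvd_prime_pow hf.prime _).1 (charpoly_dvd_pow_card h)
  have h1 := eq_of_monic_of_associated A.charpoly_monic (hm.pow i) hi
  have h2 := congrArg natDegree h1
  rw [Matrix.charpoly_natDegree_eq_dim, Fintype.card_fin, natDegree_pow, hk] at h2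
  rw [h1, Nat.eq_of_mul_eq_mul_right hf.natDegree_pos h2]

theorem eq_and_eq_of_mul_eq_mul_of_isCoprime {F : Type*} [Field F] {a b f g : F[X]}
    (ha : a.Monic) (hf : f.Monic) (h : a * b = f * g)
    (hag : IsCoprime a g) (hfb : IsCoprime f b) : a = f ∧ b = g := by
  have h1 : a = f := eq_of_monic_of_associated ha hf (associated_of_dvd_dvd
    (hag.dvd_of_dvd_mul_right (h ▸ dvd_mul_right a b))
    (hfb.dvd_of_dvd_mul_right (h.symm ▸ dvd_mul_right f g)))
  refine ⟨h1, ?_⟩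
  subst h1
  exact mul_left_cancel₀ ha.ne_zero h

/-- The primary decomposition of the space with respect to two coprime factors of the
characteristic polynomial, in matrix form. -/
theorem exists_conj_fromBlocks {F : Type*} [Field F] {n m : ℕ}
    (x : Matrix (Fin (n + m)) (Fin (n + m)) F) {f g : F[X]} (hf : f.Monic)
    (hn : f.natDegree = n) (hm : g.natDegree = m) (hfg : IsCoprime f g)
    (hx : x.charpoly = f * g) :
    ∃ (P Q : Matrix (Fin (n + m)) (Fin (n + m)) F) (a : Matrix (Fin n) (Fin n) F)
      (b : Matrix (Fin m) (Fin m) F), P * Q = 1 ∧ Q * P = 1 ∧ a.charpoly = f ∧ b.charpoly = g ∧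
      P * x * Q = Matrix.reindex finSumFinEquiv finSumFinEquiv (Matrix.fromBlocks a 0 0 b) := by
  classical
  set L : Module.End F (Fin (n + m) → F) := Matrix.toLin' x with hL
  have hLx : aeval L (f * g) = 0 := by
    rw [← hx, ← Matrix.charpoly_toLin', ← hL, LinearMap.aeval_self_charpoly]
  set U := LinearMap.ker (aeval L f) with hU
  set W := LinearMap.ker (aeval L g) with hW
  have hc : IsCompl U W := by
    refine ⟨disjoint_ker_aeval_of_isCoprime L hfg, ?_⟩
    rw [codisjoint_iff, hU, hW, sup_ker_aeval_eq_ker_aeval_mul_of_coprime L hfg, hLx,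
      LinearMap.ker_zero]
  have key : ∀ q : F[X], ∀ v ∈ LinearMap.ker (aeval L q), L v ∈ LinearMap.ker (aeval L q) := by
    intro q v hv
    have e : aeval L q (L v) = L (aeval L q v) := by
      rw [← Module.End.mul_apply, ← Module.End.mul_apply]
      nth_rw 2 3 [← aeval_X (R := F) L]
      rw [← map_mul, ← map_mul, mul_comm]
    rw [LinearMap.mem_ker] at hv ⊢
    rw [e, hv, map_zero]
  -- The restriction of `L` to the kernel of `q(L)` is annihilated by `q`.
  have kz : ∀ q : F[X], aeval (L.restrict (key q)) q = 0 := by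
    intro q
    ext v
    have e : ∀ r : F[X], ((aeval (L.restrict (key q)) r v : LinearMap.ker (aeval L q)) :
        Fin (n + m) → F) = aeval L r v := by
      intro r
      induction r using Polynomial.induction_on generalizing v with
      | C a => simp
      | add r s hr hs => simp [hr, hs]
      | monomial k a h =>
        rw [pow_succ, ← mul_assoc, map_mul _ _ X, map_mul _ _ X, Module.End.mul_apply,
          Module.End.mul_apply, h]
        simp
    rw [e, LinearMap.mem_ker.1 v.2]
    rfl
  set LU := L.restrict (key f)
  set LW := L.restrict (key g)
  have hconj : L ∘ₗ (U.prodEquivOfIsCompl W hc).toLinearMap =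
      (U.prodEquivOfIsCompl W hc).toLinearMap ∘ₗ LU.prodMap LW := by
    ext v <;> simp [LU, LW]
  have hcp : LU.charpoly * LW.charpoly = f * g := by
    rw [← LinearMap.charpoly_prodMap, ← hx, ← Matrix.charpoly_toLin', ← hL,
      ← LinearEquiv.charpoly_conj (U.prodEquivOfIsCompl W hc)]
    congr 1
    rw [LinearEquiv.conj_apply, ← hconj]
    exact LinearMap.ext fun v => congrArg L (LinearEquiv.apply_symm_apply _ v)
  obtain ⟨h1, h2⟩ := eq_and_eq_of_mul_eq_mul_of_isCoprime LU.charpoly_monic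
    hf hcp (hfg.pow_left.of_isCoprime_of_dvd_left (linearMap_charpoly_dvd_pow (kz f)))
    (hfg.pow_right.of_isCoprime_of_dvd_right (linearMap_charpoly_dvd_pow (kz g)))
  have dU : Module.finrank F U = n := by rw [← LU.charpoly_natDegree, h1, hn]
  have dW : Module.finrank F W = m := by rw [← LW.charpoly_natDegree, h2, hm]
  let bU := Module.finBasisOfFinrankEq F U dU
  let bW := Module.finBasisOfFinrankEq F W dW
  let B := ((bU.prod bW).map (U.prodEquivOfIsCompl W hc)).reindex finSumFinEquiv
  let S := Pi.basisFun F (Fin (n + m))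
  refine ⟨B.toMatrix S, S.toMatrix B, LinearMap.toMatrix bU bU LU, LinearMap.toMatrix bW bW LW,
    B.toMatrix_mul_toMatrix_flip S, S.toMatrix_mul_toMatrix_flip B, ?_, ?_, ?_⟩
  · rw [LinearMap.charpoly_toMatrix, h1]
  · rw [LinearMap.charpoly_toMatrix, h2]
  · have e : x = LinearMap.toMatrix S S L := by
      rw [← Matrix.toLin_eq_toLin'] at hL
      rw [hL, LinearMap.toMatrix_toLin]
    rw [e, basis_toMatrix_mul_linearMap_toMatrix_mul_basis_toMatrix,
      ← LinearMap.toMatrix_prodMap]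
    ext i j
    simp only [Matrix.reindex_apply, Matrix.submatrix_apply, LinearMap.toMatrix_apply, B,
      Module.Basis.reindex_apply, Module.Basis.repr_reindex, Module.Basis.map_apply,
      Module.Basis.map_repr, LinearEquiv.trans_apply, Finsupp.mapDomain_equiv_apply]
    rw [← LinearEquiv.coe_coe (U.prodEquivOfIsCompl W hc), ← LinearMap.comp_apply, hconj,
      LinearMap.comp_apply, LinearEquiv.coe_coe, LinearEquiv.symm_apply_apply]

/-! ### Semisimple matrices with irreducible minimal polynomial -/

theorem finrank_adjoinRoot {F : Type*} [Field F] (f : F[X]) :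
    Module.finrank F (AdjoinRoot f) = f.natDegree :=
  finrank_quotient_span_eq_natDegree

/-- An endomorphism annihilated by an irreducible polynomial `f` makes the space a vector space over
`F[X]/(f)`, hence is isomorphic to multiplication by the class of `X` on a power of `F[X]/(f)`. -/
theorem exists_linearEquiv_root_smul {F V : Type*} [Field F] [AddCommGroup V] [Module F V]
    [FiniteDimensional F V] {f : F[X]} [hf : Fact (Irreducible f)] {L : Module.End F V}
    (h : aeval L f = 0) {N : ℕ} (hV : Module.finrank F V = N * f.natDegree) :
    ∃ e : (Fin N → AdjoinRoot f) ≃ₗ[F] V, ∀ v, e (AdjoinRoot.root f • v) = L (e v) := by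
  let φ : AdjoinRoot f →ₐ[F] Module.End F V := Ideal.Quotient.liftₐ _ (aeval L) (by
    intro a ha
    obtain ⟨c, rfl⟩ := Ideal.mem_span_singleton.1 ha
    rw [map_mul, h, zero_mul])
  have hφ : φ (AdjoinRoot.root f) = L := by
    change aeval L X = L
    rw [aeval_X]
  let : Module (AdjoinRoot f) V := Module.compHom V φ.toRingHom
  have hsmul : ∀ (c : AdjoinRoot f) (v : V), c • v = φ c v := fun _ _ => rfl
  have : IsScalarTower F (AdjoinRoot f) V := IsScalarTower.of_algebraMap_smul fun a v => by
    rw [hsmul, AlgHom.commutes, Module.algebraMap_end_apply]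
  have : FiniteDimensional (AdjoinRoot f) V := FiniteDimensional.right F _ V
  have h1 := Module.finrank_mul_finrank F (AdjoinRoot f) V
  rw [finrank_adjoinRoot, hV, mul_comm] at h1
  have h2 : Module.finrank (AdjoinRoot f) (Fin N → AdjoinRoot f) =
      Module.finrank (AdjoinRoot f) V := by
    rw [Module.finrank_fin_fun, Nat.eq_of_mul_eq_mul_right hf.out.natDegree_pos h1]
  let e := LinearEquiv.ofFinrankEq (Fin N → AdjoinRoot f) V h2
  refine ⟨e.restrictScalars F, fun v => ?_⟩
  change e (AdjoinRoot.root f • v) = L (e v)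
  rw [map_smul, hsmul, hφ]

/-- An `F`-linear map commuting with the class of `X` is `F[X]/(f)`-linear. -/
theorem map_adjoinRoot_smul {F V W : Type*} [Field F] {f : F[X]} [AddCommGroup V] [Module F V]
    [AddCommGroup W] [Module F W] [Module (AdjoinRoot f) V] [Module (AdjoinRoot f) W]
    [IsScalarTower F (AdjoinRoot f) V] [IsScalarTower F (AdjoinRoot f) W] (ψ : V →ₗ[F] W)
    (h : ∀ v, ψ (AdjoinRoot.root f • v) = AdjoinRoot.root f • ψ v) (c : AdjoinRoot f) (v : V) :
    ψ (c • v) = c • ψ v := by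
  obtain ⟨r, rfl⟩ := AdjoinRoot.mk_surjective c
  induction r using Polynomial.induction_on generalizing v with
  | C a =>
    rw [AdjoinRoot.mk_C, ← AdjoinRoot.algebraMap_eq, algebraMap_smul, algebraMap_smul, map_smul]
  | add r s hr hs => rw [map_add, add_smul, add_smul, map_add, hr, hs]
  | monomial k a ih =>
    rw [pow_succ, ← mul_assoc, map_mul _ _ X, AdjoinRoot.mk_X, mul_smul, mul_smul, ih, h]

/-- The group `GL_k(F)` as the group of linear automorphisms of the space of column vectors. -/
def glEquiv (F : Type*) [Field F] (k : ℕ) :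
    Matrix.GeneralLinearGroup (Fin k) F ≃* ((Fin k → F) ≃ₗ[F] (Fin k → F)) :=
  Matrix.GeneralLinearGroup.toLin.trans (LinearMap.GeneralLinearGroup.generalLinearEquiv F _)

theorem glEquiv_apply {F : Type*} [Field F] {k : ℕ} (x : Matrix.GeneralLinearGroup (Fin k) F)
    (v : Fin k → F) : glEquiv F k x v = Matrix.toLinAlgEquiv' x.1 v := rfl

theorem exists_linearEquiv_root_smul_gl {F : Type*} [Field F] {f : F[X]} [Fact (Irreducible f)]
    {k N : ℕ} (hk : k = N * f.natDegree) {x : Matrix.GeneralLinearGroup (Fin k) F}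
    (hx : aeval x.1 f = 0) :
    ∃ e : (Fin N → AdjoinRoot f) ≃ₗ[F] (Fin k → F),
      ∀ v, e (AdjoinRoot.root f • v) = glEquiv F k x (e v) := by
  have h : aeval (Matrix.toLinAlgEquiv' x.1) f = 0 := by
    rw [aeval_algHom_apply, hx, map_zero]
  exact exists_linearEquiv_root_smul h (by rw [Module.finrank_fin_fun, hk])

/-- Both matrices are conjugate to multiplication by the class of `X` on the same power of
`F[X]/(f)`. -/
theorem isConj_of_aeval_eq_zero {F : Type*} [Field F] {f : F[X]} (hf : Irreducible f)
    {k N : ℕ} (hk : k = N * f.natDegree) {x y : Matrix.GeneralLinearGroup (Fin k) F}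
    (hx : aeval x.1 f = 0) (hy : aeval y.1 f = 0) : IsConj x y := by
  have : Fact (Irreducible f) := ⟨hf⟩
  obtain ⟨e, he⟩ := exists_linearEquiv_root_smul_gl hk hx
  obtain ⟨e', he'⟩ := exists_linearEquiv_root_smul_gl hk hy
  rw [isConj_iff]
  refine ⟨(glEquiv F k).symm (e.symm.trans e'), (glEquiv F k).injective ?_⟩
  rw [map_mul, map_mul, map_inv, MulEquiv.apply_symm_apply, mul_inv_eq_iff_eq_mul]
  ext1 v
  obtain ⟨v, rfl⟩ := e.surjective v
  simp [LinearEquiv.mul_apply, ← he, ← he']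

/-- The witness is multiplication by the class of `X` on a power of `F[X]/(f)`; it is invertible
because `f` has nonzero constant term. -/
theorem exists_gl_aeval_eq_zero {F : Type*} [Field F] {f : F[X]} (hf : Irreducible f)
    (h0 : f.coeff 0 ≠ 0) {k N : ℕ} (hk : k = N * f.natDegree) :
    ∃ x : Matrix.GeneralLinearGroup (Fin k) F, aeval x.1 f = 0 := by
  have : Fact (Irreducible f) := ⟨hf⟩
  have : FiniteDimensional F (AdjoinRoot f) := (AdjoinRoot.powerBasis hf.ne_zero).finite
  have hr : AdjoinRoot.root f ≠ 0 := by
    intro h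
    have h1 := AdjoinRoot.eval₂_root f
    rw [h, eval₂_at_zero] at h1
    exact h0 ((map_eq_zero _).1 h1)
  have hd : Module.finrank F (Fin N → AdjoinRoot f) = Module.finrank F (Fin k → F) := by
    rw [Module.finrank_pi_fintype, Finset.sum_const, finrank_adjoinRoot, Module.finrank_fin_fun, hk]
    simp
  let e : (Fin N → AdjoinRoot f) ≃ₗ[F] (Fin k → F) := LinearEquiv.ofFinrankEq _ _ hd
  let μ : (Fin N → AdjoinRoot f) ≃ₗ[F] (Fin N → AdjoinRoot f) :=
    (LinearEquiv.smulOfNeZero (AdjoinRoot f) _ _ hr).restrictScalars F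
  refine ⟨(glEquiv F k).symm ((e.symm.trans μ).trans e), ?_⟩
  set x := (glEquiv F k).symm ((e.symm.trans μ).trans e) with hx
  have hxe : ∀ v, Matrix.toLinAlgEquiv' x.1 (e v) = e (AdjoinRoot.root f • v) := by
    intro v
    rw [← glEquiv_apply, hx, MulEquiv.apply_symm_apply]
    simp [μ]
  have key : ∀ (r : F[X]) v, aeval (Matrix.toLinAlgEquiv' x.1) r (e v) =
      e (AdjoinRoot.mk f r • v) := by
    intro r
    induction r using Polynomial.induction_on with
    | C a =>
      intro v
      rw [AdjoinRoot.mk_C, ← AdjoinRoot.algebraMap_eq, algebraMap_smul, map_smul, aeval_C,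
        Module.algebraMap_end_apply]
    | add r s hr hs => intro v; rw [map_add, map_add, add_smul, map_add, ← hr, ← hs]; rfl
    | monomial k a ih =>
      intro v
      rw [pow_succ, ← mul_assoc, map_mul _ _ X, map_mul _ _ X, AdjoinRoot.mk_X, mul_smul, ← ih,
        aeval_X, Module.End.mul_apply, hxe]
  apply (Matrix.toLinAlgEquiv' (R := F) (n := Fin k)).injective
  rw [map_zero, ← AlgEquiv.coe_toAlgHom, ← aeval_algHom_apply]
  refine LinearMap.ext fun v => ?_
  obtain ⟨v, rfl⟩ := e.surjective v
  rw [AlgEquiv.coe_toAlgHom, key, AdjoinRoot.mk_self, zero_smul, map_zero, LinearMap.zero_apply]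

/-- The centralizer of a matrix annihilated by an irreducible polynomial `f` is a general linear
group over the field `F[X]/(f)`. -/
theorem card_centralizer_of_aeval_eq_zero {F : Type*} [Field F] {f : F[X]} (hf : Irreducible f)
    {k N : ℕ} (hk : k = N * f.natDegree) {x : Matrix.GeneralLinearGroup (Fin k) F}
    (hx : aeval x.1 f = 0) :
    haveI : Fact (Irreducible f) := ⟨hf⟩
    Nat.card (Subgroup.centralizer {x}) =
      Nat.card (Matrix.GeneralLinearGroup (Fin N) (AdjoinRoot f)) := by
  have : Fact (Irreducible f) := ⟨hf⟩
  obtain ⟨e, he⟩ := exists_linearEquiv_root_smul_gl hk hx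
  refine Eq.symm (Nat.card_congr ((glEquiv (AdjoinRoot f) N).toEquiv.trans ?_))
  let T : ((Fin N → AdjoinRoot f) ≃ₗ[AdjoinRoot f] (Fin N → AdjoinRoot f)) →
      Subgroup.centralizer {x} := fun ψ =>
    ⟨(glEquiv F k).symm ((e.symm.trans (ψ.restrictScalars F)).trans e), by
      rw [Subgroup.mem_centralizer_singleton_iff]
      apply (glEquiv F k).injective
      rw [map_mul, map_mul, MulEquiv.apply_symm_apply]
      ext1 v
      obtain ⟨v, rfl⟩ := e.surjective v
      simp [LinearEquiv.mul_apply, ← he]⟩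
  refine Equiv.ofBijective T ⟨fun ψ ψ' h => ?_, fun y => ?_⟩
  · have h1 := (glEquiv F k).symm.injective (Subtype.ext_iff.1 h)
    ext1 v
    have h2 := LinearEquiv.congr_fun h1 (e v)
    simpa using h2
  · have hy := Subgroup.mem_centralizer_singleton_iff.1 y.2
    let ψ₀ : (Fin N → AdjoinRoot f) ≃ₗ[F] (Fin N → AdjoinRoot f) :=
      (e.trans (glEquiv F k y)).trans e.symm
    have hroot : ∀ v, ψ₀ (AdjoinRoot.root f • v) = AdjoinRoot.root f • ψ₀ v := by
      intro v
      apply e.injective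
      have h1 := LinearEquiv.congr_fun (congrArg (glEquiv F k) hy) (e v)
      rw [map_mul, map_mul, LinearEquiv.mul_apply, LinearEquiv.mul_apply] at h1
      rw [he]
      simp only [ψ₀, LinearEquiv.trans_apply, LinearEquiv.apply_symm_apply, he]
      exact h1
    let ψ : (Fin N → AdjoinRoot f) ≃ₗ[AdjoinRoot f] (Fin N → AdjoinRoot f) :=
      { ψ₀ with map_smul' := map_adjoinRoot_smul ψ₀.toLinearMap hroot }
    refine ⟨ψ, Subtype.ext ?_⟩
    change (glEquiv F k).symm ((e.symm.trans (ψ.restrictScalars F)).trans e) = y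
    rw [MulEquiv.symm_apply_eq]
    ext1 v
    change e (e.symm (glEquiv F k y (e (e.symm v)))) = glEquiv F k y v
    rw [e.apply_symm_apply, e.apply_symm_apply]

/-- The order of `GL_N` of a field with `q` elements, written with `ψ_N(q)`. -/
theorem card_gl_eq_psi {K : Type*} [Field K] [Fintype K] (N : ℕ) :
    (Nat.card (Matrix.GeneralLinearGroup (Fin N) K) : ℂ) =
      (Fintype.card K : ℂ) ^ N.choose 2 * psi N (Fintype.card K) := by
  rw [Matrix.card_GL_field]
  set q := Fintype.card K
  have hq : 1 ≤ q := Fintype.card_pos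
  rw [Fin.prod_univ_eq_prod_range (fun i => q ^ N - q ^ i), Nat.cast_prod]
  have h1 : ∀ i ∈ Finset.range N, ((q ^ N - q ^ i : ℕ) : ℂ) =
      (q : ℂ) ^ i * ((q : ℂ) ^ (N - 1 - i + 1) - 1) := by
    intro i hi
    have hi' := Finset.mem_range.1 hi
    rw [Nat.cast_sub (Nat.pow_le_pow_right hq hi'.le), mul_sub, ← pow_add,
      show i + (N - 1 - i + 1) = N by omega]
    push_cast
    ring
  have h2 : ∀ M, ∏ i ∈ Finset.range M, ((q : ℂ) ^ (i + 1) - 1) = psi M q := by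
    intro M
    induction M with
    | zero => simp [psi]
    | succ M ih => rw [Finset.prod_range_succ, ih, psi, psi, Finset.prod_Icc_succ_top (by omega)]
  rw [Finset.prod_congr rfl h1, Finset.prod_mul_distrib, Finset.prod_pow_eq_pow_sum,
    Finset.sum_range_id, ← Nat.choose_two_right,
    Finset.prod_range_reflect (fun i => (q : ℂ) ^ (i + 1) - 1), h2]

theorem psi_ne_zero {q : ℕ} (hq : 2 ≤ q) (N : ℕ) : psi N q ≠ 0 := by
  refine Finset.prod_ne_zero_iff.2 fun i hi => ?_
  have h1 : 1 < q ^ i := Nat.one_lt_pow (by have := (Finset.mem_Icc.1 hi).1; omega) (by omega)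
  rw [sub_ne_zero]
  exact_mod_cast h1.ne'

/-! ### Block diagonal matrices and regular elements -/

theorem coe_blockDiag {p n m : ℕ} (a : GLp p n) (b : GLp p m) :
    (blockDiag p n m (a, b)).1 =
      Matrix.reindex finSumFinEquiv finSumFinEquiv (Matrix.fromBlocks a.1 0 0 b.1) := rfl

theorem blockDiag_injective (p n m : ℕ) : Function.Injective (blockDiag p n m) := by
  rintro ⟨a, b⟩ ⟨a', b'⟩ h
  have h1 := congrArg Units.val h
  rw [coe_blockDiag, coe_blockDiag, EmbeddingLike.apply_eq_iff_eq, Matrix.fromBlocks_inj] at h1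
  exact Prod.ext (Units.ext h1.1) (Units.ext h1.2.2.2)

theorem charpoly_blockDiag {p n m : ℕ} (a : GLp p n) (b : GLp p m) :
    (blockDiag p n m (a, b)).1.charpoly = a.1.charpoly * b.1.charpoly := by
  rw [coe_blockDiag, Matrix.charpoly_reindex, Matrix.charpoly_fromBlocks_zero₁₂]

theorem charpoly_conj {p n : ℕ} (h g : GLp p n) :
    (h * g * h⁻¹).1.charpoly = g.1.charpoly := by
  simp

theorem isPRegular_blockDiag_iff {p n m : ℕ} {a : GLp p n} {b : GLp p m} :
    IsPRegular (blockDiag p n m (a, b)) ↔ IsPRegular a ∧ IsPRegular b := by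
  refine ⟨fun h => ?_, fun h => isPRegular_blockDiag h.1 h.2⟩
  unfold IsPRegular at *
  rw [orderOf_injective _ (blockDiag_injective p n m), Prod.orderOf] at h
  exact ⟨h.coprime_dvd_left (Nat.dvd_lcm_left _ _), h.coprime_dvd_left (Nat.dvd_lcm_right _ _)⟩

theorem piFun_apply_of {p n : ℕ} {f : (ZMod p)[X]} {g : GLp p n} (h : IsPRegular g)
    (hf : g.1.charpoly = f) : (piFun p n f).1 g = 1 := if_pos ⟨h, hf⟩

theorem piFun_apply_of_not {p n : ℕ} {f : (ZMod p)[X]} {g : GLp p n}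
    (h : ¬ (IsPRegular g ∧ g.1.charpoly = f)) : (piFun p n f).1 g = 0 := if_neg h

variable {p : ℕ} [Fact p.Prime]

theorem indFun_piFun_eq_zero {n m : ℕ} {f g : (ZMod p)[X]} {x : GLp p (n + m)}
    (h : ¬ (IsPRegular x ∧ x.1.charpoly = f * g)) :
    indFun (piFun p n f).1 (piFun p m g).1 x = 0 := by
  by_cases hx : IsPRegular x
  · unfold indFun
    rw [Finset.sum_eq_zero, mul_zero]
    refine fun k _ => Finset.sum_eq_zero fun a _ => Finset.sum_eq_zero fun b _ => ?_
    split_ifs with e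
    · by_cases ha : IsPRegular a ∧ a.1.charpoly = f
      · by_cases hb : IsPRegular b ∧ b.1.charpoly = g
        · refine absurd ⟨hx, ?_⟩ h
          rw [← charpoly_conj k x, e, charpoly_blockDiag, ha.2, hb.2]
        · rw [piFun_apply_of_not hb, mul_zero]
      · rw [piFun_apply_of_not ha, zero_mul]
    · rfl
  · exact (indFun_mem (piFun p n f).2 (piFun p m g).2).2 x hx

/-! ### Coprime characteristic polynomials -/

/-- There are no nonzero intertwiners between matrices annihilated by coprime polynomials. -/
theorem eq_zero_of_mul_eq_mul_of_isCoprime {F ι κ : Type*} [Field F] [Fintype ι] [DecidableEq ι]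
    [Fintype κ] [DecidableEq κ] {a : Matrix ι ι F} {b : Matrix κ κ F} {B : Matrix ι κ F}
    {f g : F[X]} (hf : aeval a f = 0) (hg : aeval b g = 0) (h : IsCoprime f g)
    (hB : a * B = B * b) : B = 0 := by
  have key : ∀ r : F[X], aeval a r * B = B * aeval b r := by
    intro r
    induction r using Polynomial.induction_on with
    | C c => simp [Algebra.algebraMap_eq_smul_one]
    | add r s hr hs => rw [map_add, map_add, Matrix.add_mul, Matrix.mul_add, hr, hs]
    | monomial k c ih =>
      rw [pow_succ, ← mul_assoc, map_mul _ _ X, map_mul _ _ X, aeval_X, aeval_X, Matrix.mul_assoc,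
        hB, ← Matrix.mul_assoc, ih, Matrix.mul_assoc]
  obtain ⟨u, v, huv⟩ := h
  have h1 : aeval b (u * f) = 1 := by
    have := congrArg (aeval b) huv
    rwa [map_add, map_mul _ v, hg, mul_zero, add_zero, map_one] at this
  have h2 := key (u * f)
  rw [h1, map_mul, hf, mul_zero, Matrix.zero_mul, Matrix.mul_one] at h2
  exact h2.symm

/-- An element conjugating one block diagonal matrix to another, with matching coprime
characteristic polynomials of the blocks, is itself block diagonal: its off-diagonal blocks
intertwine blocks with coprime characteristic polynomials. -/
theorem mem_range_blockDiag_of_conj {n m : ℕ} {f g : (ZMod p)[X]} (hfg : IsCoprime f g)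
    {h : GLp p (n + m)} {a a' : GLp p n} {b b' : GLp p m}
    (ha : a.1.charpoly = f) (hb : b.1.charpoly = g)
    (ha' : a'.1.charpoly = f) (hb' : b'.1.charpoly = g)
    (e : h * blockDiag p n m (a, b) * h⁻¹ = blockDiag p n m (a', b')) :
    h ∈ Set.range (blockDiag p n m) := by
  set H := (Matrix.reindex finSumFinEquiv finSumFinEquiv).symm h.1 with hH
  have hh : h.1 = Matrix.reindex finSumFinEquiv finSumFinEquiv H := by
    rw [hH, Equiv.apply_symm_apply]
  have e1 : H * Matrix.fromBlocks a.1 0 0 b.1 = Matrix.fromBlocks a'.1 0 0 b'.1 * H := by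
    apply (Matrix.reindex finSumFinEquiv finSumFinEquiv).injective
    have e2 := congrArg Units.val (mul_inv_eq_iff_eq_mul.1 e)
    rw [Units.val_mul, Units.val_mul, coe_blockDiag, coe_blockDiag, hh] at e2
    simpa [Matrix.submatrix_mul_equiv] using e2
  rw [← Matrix.fromBlocks_toBlocks H, Matrix.fromBlocks_multiply, Matrix.fromBlocks_multiply,
    Matrix.fromBlocks_inj] at e1
  simp only [Matrix.mul_zero, Matrix.zero_mul, add_zero, zero_add] at e1
  have z1 : H.toBlocks₁₂ = 0 := eq_zero_of_mul_eq_mul_of_isCoprime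
    (ha' ▸ Matrix.aeval_self_charpoly a'.1) (hb ▸ Matrix.aeval_self_charpoly b.1) hfg e1.2.1.symm
  have z2 : H.toBlocks₂₁ = 0 := eq_zero_of_mul_eq_mul_of_isCoprime
    (hb' ▸ Matrix.aeval_self_charpoly b'.1) (ha ▸ Matrix.aeval_self_charpoly a.1) hfg.symm
    e1.2.2.1.symm
  have hHd : H = Matrix.fromBlocks H.toBlocks₁₁ 0 0 H.toBlocks₂₂ :=
    (Matrix.fromBlocks_toBlocks H).symm.trans (by rw [z1, z2])
  have hdet : IsUnit (H.toBlocks₁₁.det * H.toBlocks₂₂.det) := by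
    rw [← Matrix.det_fromBlocks_zero₁₂ _ 0, ← hHd, ← Matrix.det_reindex_self finSumFinEquiv, ← hh]
    exact (Matrix.isUnit_iff_isUnit_det _).1 h.isUnit
  rw [IsUnit.mul_iff] at hdet
  refine ⟨(Matrix.GeneralLinearGroup.mk'' _ hdet.1, Matrix.GeneralLinearGroup.mk'' _ hdet.2),
    Units.ext ?_⟩
  rw [coe_blockDiag, hh]
  exact congrArg _ hHd.symm

theorem exists_conj_blockDiag {n m : ℕ} {f g : (ZMod p)[X]} (hf : f.Monic)
    (hn : f.natDegree = n) (hm : g.natDegree = m) (hfg : IsCoprime f g) {x : GLp p (n + m)}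
    (hx : x.1.charpoly = f * g) :
    ∃ (h : GLp p (n + m)) (a : GLp p n) (b : GLp p m), a.1.charpoly = f ∧ b.1.charpoly = g ∧
      h * x * h⁻¹ = blockDiag p n m (a, b) := by
  obtain ⟨P, Q, a, b, hPQ, hQP, ha, hb, e⟩ := exists_conj_fromBlocks x.1 hf hn hm hfg hx
  have hdet : IsUnit (a.det * b.det) := by
    rw [← Matrix.det_fromBlocks_zero₁₂ _ 0, ← Matrix.det_reindex_self finSumFinEquiv, ← e,
      ← Matrix.isUnit_iff_isUnit_det]
    exact ((Units.mk P Q hPQ hQP).isUnit.mul x.isUnit).mul (Units.mk Q P hQP hPQ).isUnit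
  rw [IsUnit.mul_iff] at hdet
  exact ⟨⟨P, Q, hPQ, hQP⟩, Matrix.GeneralLinearGroup.mk'' a hdet.1,
    Matrix.GeneralLinearGroup.mk'' b hdet.2, ha, hb, Units.ext e⟩

/-- The conjugates of `diag(a, b)` that are again block diagonal of the right type come exactly from
the `|GL_n| |GL_m|` block diagonal conjugators, which cancels the normalizing factor. -/
theorem indFun_piFun_of_isCoprime {n m : ℕ} {f g : (ZMod p)[X]} (hf : f.Monic)
    (hn : f.natDegree = n) (hm : g.natDegree = m) (hfg : IsCoprime f g) :
    indFun (piFun p n f).1 (piFun p m g).1 = (piFun p (n + m) (f * g)).1 := by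
  classical
  funext x
  by_cases hx : IsPRegular x ∧ x.1.charpoly = f * g
  swap
  · rw [indFun_piFun_eq_zero hx, piFun_apply_of_not hx]
  rw [piFun_apply_of hx.1 hx.2]
  obtain ⟨h, a, b, ha, hb, e⟩ := exists_conj_blockDiag hf hn hm hfg hx.2
  rw [← (indFun_mem (piFun p n f).2 (piFun p m g).2).1 h x, e]
  have hreg := isPRegular_blockDiag_iff.1 (e ▸ (isPRegular_conj h x).2 hx.1)
  have hsum : (∑ k : GLp p (n + m), ∑ a' : GLp p n, ∑ b' : GLp p m,
      if k * blockDiag p n m (a, b) * k⁻¹ = blockDiag p n m (a', b') then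
        (piFun p n f).1 a' * (piFun p m g).1 b' else 0) = ∑ _w : GLp p n × GLp p m, (1 : ℂ) := by
    symm
    refine Finset.sum_of_injOn (blockDiag p n m) (blockDiag_injective p n m).injOn
      (fun _ _ => Finset.mem_coe.2 (Finset.mem_univ _)) ?_ ?_
    · intro k _ hk
      refine Finset.sum_eq_zero fun a' _ => Finset.sum_eq_zero fun b' _ => ?_
      split_ifs with e'
      · by_cases ha' : IsPRegular a' ∧ a'.1.charpoly = f
        · by_cases hb' : IsPRegular b' ∧ b'.1.charpoly = g
          · refine absurd ?_ hk
            rw [Finset.coe_univ, Set.image_univ]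
            exact mem_range_blockDiag_of_conj hfg ha hb ha'.2 hb'.2 e'
          · rw [piFun_apply_of_not hb', mul_zero]
        · rw [piFun_apply_of_not ha', zero_mul]
      · rfl
    · rintro ⟨u, v⟩ _
      rw [Finset.sum_eq_single (u * a * u⁻¹), Finset.sum_eq_single (v * b * v⁻¹), if_pos,
        (piFun p n f).2.1, (piFun p m g).2.1, piFun_apply_of hreg.1 ha, piFun_apply_of hreg.2 hb,
        mul_one]
      · rw [← map_inv, ← map_mul, ← map_mul]
        rfl
      · intro b' _ hb'
        refine if_neg fun e' => hb' ?_
        rw [← map_inv, ← map_mul, ← map_mul] at e'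
        exact (congrArg Prod.snd (blockDiag_injective p n m e')).symm
      · exact fun h => absurd (Finset.mem_univ _) h
      · intro a' _ ha'
        refine Finset.sum_eq_zero fun b' _ => if_neg fun e' => ha' ?_
        rw [← map_inv, ← map_mul, ← map_mul] at e'
        exact (congrArg Prod.fst (blockDiag_injective p n m e')).symm
      · exact fun h => absurd (Finset.mem_univ _) h
  unfold indFun
  have h1 : (Fintype.card (GLp p n) : ℂ) ≠ 0 := Nat.cast_ne_zero.2 Fintype.card_ne_zero
  have h2 : (Fintype.card (GLp p m) : ℂ) ≠ 0 := Nat.cast_ne_zero.2 Fintype.card_ne_zero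
  convert! one_div_mul_cancel (mul_ne_zero h1 h2) using 2
  convert hsum using 1
  · simp

/-! ### Powers of an irreducible polynomial -/

/-- Regularity makes the minimal polynomial squarefree, as a divisor of the separable `X ^ r - 1`
with `r` prime to `p`. Conversely, if `f(x) = 0`, then the order of `x` divides `p ^ deg f - 1`. -/
theorem isPRegular_and_charpoly_eq_pow_iff {f : (ZMod p)[X]} (hf : Irreducible f) (hm : f.Monic)
    {k N : ℕ} (hk : k = N * f.natDegree) (x : GLp p k) :
    IsPRegular x ∧ x.1.charpoly = f ^ N ↔ aeval x.1 f = 0 := by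
  constructor
  · rintro ⟨hx, hc⟩
    have hsep : (X ^ orderOf x - 1 : (ZMod p)[X]).Separable := by
      rw [X_pow_sub_one_separable_iff, Ne, ZMod.natCast_eq_zero_iff]
      exact fun h => (Fact.out : p.Prime).one_lt.ne' (Nat.Coprime.eq_one_of_dvd hx.symm h)
    have hdvd : minpoly (ZMod p) x.1 ∣ X ^ orderOf x - 1 := by
      apply minpoly.dvd
      have h1 := congrArg Units.val (pow_orderOf_eq_one x)
      rw [Units.val_pow_eq_pow_val, Units.val_one] at h1
      simp [h1]
    have hsq : Squarefree (minpoly (ZMod p) x.1) := hsep.squarefree.squarefree_of_dvd hdvd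
    have h2 : minpoly (ZMod p) x.1 ∣ f ^ N := hc ▸ Matrix.minpoly_dvd_charpoly x.1
    have h3 : minpoly (ZMod p) x.1 ∣ f := by
      rcases eq_or_ne N 0 with rfl | hN
      · exact h2.trans (by rw [pow_zero]; exact one_dvd f)
      · exact (hsq.dvd_pow_iff_dvd hN).1 h2
    exact (minpoly.dvd_iff).1 h3
  · intro h
    refine ⟨?_, charpoly_eq_pow_of_aeval_eq_zero hf hm hk h⟩
    have : Fact (Irreducible f) := ⟨hf⟩
    have : FiniteDimensional (ZMod p) (AdjoinRoot f) := hm.finite_adjoinRoot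
    have : Finite (AdjoinRoot f) := Module.finite_of_finite (ZMod p)
    have : Fintype (AdjoinRoot f) := Fintype.ofFinite _
    -- In the finite field `𝔽_p[X]/(f)` with `q` elements the polynomial
    -- `X ^ q - X` vanishes at every element, in particular at the class of `X`.
    have h1 : f ∣ X ^ Fintype.card (AdjoinRoot f) - X := by
      rw [← AdjoinRoot.mk_eq_zero, map_sub, map_pow, FiniteField.pow_card, sub_self]
    have h2 : x ^ Fintype.card (AdjoinRoot f) = x := by
      obtain ⟨c, hc⟩ := h1
      have h3 := congrArg (aeval x.1) hc
      rw [map_mul, h, zero_mul, map_sub, map_pow, aeval_X, sub_eq_zero] at h3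
      exact Units.ext h3
    have hc : Fintype.card (AdjoinRoot f) = p ^ f.natDegree := by
      rw [Module.card_eq_pow_finrank (K := ZMod p), ZMod.card, finrank_adjoinRoot]
    rw [hc] at h2
    have hp : p ∣ p ^ f.natDegree := dvd_pow_self p hf.natDegree_pos.ne'
    have h3 : orderOf x ∣ p ^ f.natDegree - 1 := by
      apply orderOf_dvd_of_pow_eq_one
      have h4 : x ^ (p ^ f.natDegree - 1) * x = 1 * x := by
        rw [← pow_succ, Nat.sub_add_cancel (Nat.pow_pos (Fact.out : p.Prime).pos), h2, one_mul]
      exact mul_right_cancel h4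
    refine Nat.Coprime.coprime_dvd_left h3 (Nat.Coprime.coprime_dvd_right hp ?_)
    exact (Nat.coprime_self_sub_left (Nat.pow_pos (Fact.out : p.Prime).pos)).2
      (Nat.coprime_one_left _)

/-- The elements annihilated by `f` form a single conjugacy class, whose size is given by the orbit
formula. -/
theorem sum_piFun_mul_card {f : (ZMod p)[X]} (hf : Irreducible f) (hm : f.Monic)
    (h0 : f.coeff 0 ≠ 0) {k N : ℕ} (hk : k = N * f.natDegree) :
    haveI : Fact (Irreducible f) := ⟨hf⟩
    (∑ x, (piFun p k (f ^ N)).1 x) *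
      (Nat.card (Matrix.GeneralLinearGroup (Fin N) (AdjoinRoot f)) : ℂ) =
      Fintype.card (GLp p k) := by
  classical
  obtain ⟨x, hx⟩ := exists_gl_aeval_eq_zero hf h0 hk
  have h1 : (∑ x, (piFun p k (f ^ N)).1 x) = (MulAction.orbit (ConjAct (GLp p k)) x).ncard := by
    have h2 : MulAction.orbit (ConjAct (GLp p k)) x =
        (Finset.univ.filter fun y : GLp p k => IsPRegular y ∧ y.1.charpoly = f ^ N) := by
      ext y
      rw [ConjAct.mem_orbit_conjAct, Finset.coe_filter_univ, Set.mem_ofPred_eq]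
      constructor
      · intro hy
        obtain ⟨c, rfl⟩ := isConj_iff.1 hy.symm
        rw [isPRegular_conj, charpoly_conj]
        exact (isPRegular_and_charpoly_eq_pow_iff hf hm hk x).2 hx
      · intro hy
        exact isConj_of_aeval_eq_zero hf hk ((isPRegular_and_charpoly_eq_pow_iff hf hm hk y).1 hy) hx
    rw [h2, Set.ncard_coe_finset, Finset.card_filter, Nat.cast_sum]
    refine Finset.sum_congr rfl fun y _ => ?_
    by_cases hy : IsPRegular y ∧ y.1.charpoly = f ^ N
    · rw [piFun_apply_of hy.1 hy.2, if_pos hy, Nat.cast_one]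
    · rw [piFun_apply_of_not hy, if_neg hy, Nat.cast_zero]
  rw [h1, ← card_centralizer_of_aeval_eq_zero hf hk hx,
    Subgroup.nat_card_centralizer_nat_card_stabilizer, ← MulAction.index_stabilizer, ← Nat.cast_mul,
    Subgroup.index_mul_card, ← Nat.card_eq_fintype_card]
  rfl

/-- In the sum over all `x`, each triple `(h, a, b)` occurs for exactly one `x`, namely
`h⁻¹ diag(a, b) h`. -/
theorem sum_indFun {n m : ℕ} (ρ : GLp p n → ℂ) (σ : GLp p m → ℂ) :
    ∑ x, indFun ρ σ x = Fintype.card (GLp p (n + m)) /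
      ((Fintype.card (GLp p n) : ℂ) * (Fintype.card (GLp p m) : ℂ)) *
        ((∑ a, ρ a) * ∑ b, σ b) := by
  classical
  unfold indFun
  rw [← Finset.mul_sum, Finset.sum_comm]
  have h1 : ∀ h : GLp p (n + m), (∑ g : GLp p (n + m), ∑ a : GLp p n, ∑ b : GLp p m,
      if h * g * h⁻¹ = blockDiag p n m (a, b) then ρ a * σ b else 0) =
        (∑ a, ρ a) * ∑ b, σ b := by
    intro h
    rw [Finset.sum_comm, Finset.sum_mul_sum]
    refine Finset.sum_congr rfl fun a _ => ?_
    rw [Finset.sum_comm]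
    refine Finset.sum_congr rfl fun b _ => ?_
    rw [Finset.sum_eq_single (h⁻¹ * blockDiag p n m (a, b) * h)]
    · rw [if_pos (by group)]
    · intro g _ hg
      refine if_neg fun e => hg ?_
      rw [← e]
      group
    · exact fun h => absurd (Finset.mem_univ _) h
  have h2 := Finset.sum_congr (rfl : (Finset.univ : Finset (GLp p (n + m))) = _) fun h _ => h1 h
  rw [Finset.sum_const, Finset.card_univ, nsmul_eq_mul] at h2
  rw [div_mul_eq_mul_div, div_mul_eq_mul_div, one_mul]
  congr 1

/-- Both sides are multiples of the indicator function of one conjugacy class, so it is enough to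
compare their sums over the group; this gives the factor `|GL_{n+m}(K)| / (|GL_n(K)| |GL_m(K)|)`
with `K = 𝔽_p[X]/(f)`. -/
theorem indFun_piFun_pow {f : (ZMod p)[X]} (hf : Irreducible f) (hm : f.Monic)
    (h0 : f.coeff 0 ≠ 0) {k l n m d : ℕ} (hd : f.natDegree = d) (hk : k = n * d) (hl : l = m * d) :
    indFun (piFun p k (f ^ n)).1 (piFun p l (f ^ m)).1 =
      ((p : ℂ) ^ (d * m * n) * (psi (n + m) ((p : ℂ) ^ d) /
        (psi n ((p : ℂ) ^ d) * psi m ((p : ℂ) ^ d)))) • (piFun p (k + l) (f ^ (n + m))).1 := by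
  subst hd
  have : Fact (Irreducible f) := ⟨hf⟩
  have : FiniteDimensional (ZMod p) (AdjoinRoot f) := hm.finite_adjoinRoot
  have : Finite (AdjoinRoot f) := Module.finite_of_finite (ZMod p)
  let _ : Fintype (AdjoinRoot f) := Fintype.ofFinite _
  have hq : Fintype.card (AdjoinRoot f) = p ^ f.natDegree := by
    rw [Module.card_eq_pow_finrank (K := ZMod p), ZMod.card, finrank_adjoinRoot]
  have hkl : k + l = (n + m) * f.natDegree := by rw [hk, hl, add_mul]
  obtain ⟨x, hx⟩ := exists_gl_aeval_eq_zero hf h0 hkl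
  -- `c` is the value of the product on the class annihilated by `f`.
  set c := indFun (piFun p k (f ^ n)).1 (piFun p l (f ^ m)).1 x with hc
  have hfun : indFun (piFun p k (f ^ n)).1 (piFun p l (f ^ m)).1 =
      c • (piFun p (k + l) (f ^ (n + m))).1 := by
    funext y
    rw [Pi.smul_apply, smul_eq_mul]
    by_cases hy : IsPRegular y ∧ y.1.charpoly = f ^ (n + m)
    · obtain ⟨h, rfl⟩ := isConj_iff.1 (isConj_of_aeval_eq_zero hf hkl hx
        ((isPRegular_and_charpoly_eq_pow_iff hf hm hkl y).1 hy))
      rw [piFun_apply_of hy.1 hy.2, mul_one, hc]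
      exact (indFun_mem (piFun p k (f ^ n)).2 (piFun p l (f ^ m)).2).1 h x
    · rw [piFun_apply_of_not hy, mul_zero]
      exact indFun_piFun_eq_zero (by rwa [← pow_add])
  rw [hfun]
  congr 1
  have h1 := sum_indFun (piFun p k (f ^ n)).1 (piFun p l (f ^ m)).1
  rw [hfun] at h1
  simp only [Pi.smul_apply, smul_eq_mul] at h1
  rw [← Finset.mul_sum] at h1
  have s1 := sum_piFun_mul_card hf hm h0 hk
  have s2 := sum_piFun_mul_card hf hm h0 hl
  have s3 := sum_piFun_mul_card hf hm h0 hkl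
  rw [card_gl_eq_psi, hq] at s1 s2 s3
  have hq2 : 2 ≤ p ^ f.natDegree := (Fact.out : p.Prime).two_le.trans
    (Nat.le_self_pow hf.natDegree_pos.ne' p)
  have p1 := psi_ne_zero hq2 n
  have p2 := psi_ne_zero hq2 m
  have c1 : (Fintype.card (GLp p k) : ℂ) ≠ 0 := Nat.cast_ne_zero.2 Fintype.card_ne_zero
  have c2 : (Fintype.card (GLp p l) : ℂ) ≠ 0 := Nat.cast_ne_zero.2 Fintype.card_ne_zero
  have c3 : (Fintype.card (GLp p (k + l)) : ℂ) ≠ 0 := Nat.cast_ne_zero.2 Fintype.card_ne_zero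
  -- The source of the exponent `m * n`: `|GL_N(K)| = q ^ (N.choose 2) * ψ_N(q)`.
  have hch : (n + m).choose 2 = n.choose 2 + m.choose 2 + m * n := by
    apply Nat.cast_injective (R := ℚ)
    push_cast [Nat.cast_choose_two]
    ring
  have hp0 : (p : ℂ) ≠ 0 := Nat.cast_ne_zero.2 (Fact.out : p.Prime).ne_zero
  push_cast at s1 s2 s3 p1 p2
  rw [mul_assoc, pow_mul _ f.natDegree]
  have Q0 : (p : ℂ) ^ f.natDegree ≠ 0 := pow_ne_zero _ hp0
  generalize (p : ℂ) ^ f.natDegree = Q at *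
  rw [hch, pow_add Q, pow_add Q] at s3
  rw [← s3] at c3
  have c4 := left_ne_zero_of_mul c3
  rw [← s1, ← s2, ← s3] at h1
  rw [← s1] at c1
  rw [← s2] at c2
  have c5 := left_ne_zero_of_mul c1
  have c6 := left_ne_zero_of_mul c2
  apply mul_right_cancel₀ c4
  rw [h1]
  field_simp

theorem piElt_eq_of {f : (ZMod p)[X]} {k : ℕ} (h : f.natDegree = k) :
    piElt f = DirectSum.of (fun n : ℕ => RegClassFun p n) k (piFun p k f) := by
  subst h
  rfl

end RegClass

theorem mainTheorem3 (p : ℕ) [Fact p.Prime] :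
    (∀ f g : Polynomial (ZMod p), f.Monic → g.Monic → f.coeff 0 ≠ 0 → g.coeff 0 ≠ 0 →
      IsCoprime f g → RegClass.piElt f * RegClass.piElt g = RegClass.piElt (f * g)) ∧
    (∀ f : Polynomial (ZMod p), f.Monic → f.coeff 0 ≠ 0 → Irreducible f →
      ∀ d : ℕ, f.natDegree = d → ∀ n m : ℕ,
        RegClass.piElt (f ^ n) * RegClass.piElt (f ^ m) =
          ((p : ℂ) ^ (d * m * n) *
            (RegClass.psi (n + m) ((p : ℂ) ^ d) /
              (RegClass.psi n ((p : ℂ) ^ d) * RegClass.psi m ((p : ℂ) ^ d)))) •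
            RegClass.piElt (f ^ (n + m))) := by
  refine ⟨fun f g hf hg _ _ hfg => ?_, fun f hm h0 hf d hd n m => ?_⟩
  · rw [RegClass.piElt_eq_of (hf.natDegree_mul hg), RegClass.piElt, RegClass.piElt,
      DirectSum.of_mul_of]
    congr 1
    exact Subtype.ext (RegClass.indFun_piFun_of_isCoprime hf rfl rfl hfg)
  · have hk := hd ▸ Polynomial.natDegree_pow f n
    have hl := hd ▸ Polynomial.natDegree_pow f m
    rw [RegClass.piElt_eq_of (f := f ^ (n + m)) (k := (f ^ n).natDegree + (f ^ m).natDegree)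
      (by rw [hk, hl, Polynomial.natDegree_pow, hd, add_mul]), RegClass.piElt, RegClass.piElt,
      DirectSum.of_mul_of, ← DirectSum.of_smul]
    congr 1
    exact Subtype.ext (RegClass.indFun_piFun_pow hf hm h0 hd hk hl)
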